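/- Let $Q$ be a compact (Hausdorff) DJS-hypergroup (i.e. a hypergroup in the sense of Dunkl, Jewett and Spector) with neutral element $e$, involution $x\mapsto x^\dagger$, convolution $\ast$ on the space $M(Q)=C(Q)'$ of complex Radon measures, and normalized Haar measure $\mu$. Put $\Delta: C(Q)\to C(Q)\otimes C(Q)=C(Q\times Q)$, $(\Delta f)(x,y)=\langle\delta_x\ast\delta_y,f\rangle$, $\ \epsilon(f)=f(e)$ and $f^\star(x)=\overline{f(x^\dagger)}$. Let $Y$ be a compact Hausdorff space and $\phi:Q\to Y$ an orbital map, i.e. an open continuous surjection. The sets $\phi^{-1}(y)$, $y\in Y$, are called $\phi$-orbits, and $B\subset C(Q)$ denotes the $C^*$-subalgebra of functions that are constant on every $\phi$-orbit. For $\xi\in M(Q)$ let $\phi_*\xi\in M(Y)$ be given by $\langle\phi_*\xi,f\rangle=\langle\xi,f\circ\phi\rangle$; $\xi$ is called $\phi$-consistent if $\phi_*(\xi\ast\nu)=0=\phi_*(\nu\ast\xi)$ for every $\nu\in M(Q)$ with $\phi_*\nu=0$. Let $q_y\in M(Q)$, $y\in Y$, be a family of probability measures, and suppose that (a) $\phi^{-1}(\phi(e))=\{e\}$;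 (b) if $A$ is a $\phi$-orbit, then so is $A^\dagger$; (c) $\operatorname{supp} q_y\subset\phi^{-1}(y)$ for every $y\in Y$. For $f\in C(Q)$ and $x\in Q$ put $(Pf)(x)=\langle q_{\phi(x)},f\rangle$, and consider the following property: (E) $P$ maps $C(Q)$ into $B$ (in particular each $Pf$ is continuous) and is a conditional expectation of $C(Q)$ onto the unital $C^*$-subalgebra $B$ (a positive $B$-bilinear projection onto $B$ of norm one); it is $\mu$-invariant, $\int Pf\,d\mu=\int f\,d\mu$; and, with $\tilde\Delta=(P\otimes P)\circ\Delta$, 1. $\tilde\Delta(f)=\tilde\Delta(Pf)$ for all $f\in C(Q)$; 2. $P(f^\star)=(Pf)^\star$ for all $f\in C(Q)$; 3. $P$ and $P\otimes P$ leave the distinguished dense subalgebras $A_0\subset C(Q)$ and $\tilde A_0\subset C(Q\times Q)$ invariant, and $P\circ\sigma_z=\sigma_z\circ P$ on $A_0$ for all $z\in\mathbb C$, where for the ordinary hypergroup $Q$ one has $\sigma_z=\mathrm{id}$, $A_0=C(Q)$, $\tilde A_0=C(Q\times Q)$ (so that this condition is automatic); 4. $\epsilon$ is a counit for $\tilde\Delta$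 on $B$: $(\epsilon\otimes\mathrm{id})\tilde\Delta(b)=b=(\mathrm{id}\otimes\epsilon)\tilde\Delta(b)$ for all $b\in B$. Then: * if (d) each $q_y$, $y\in Y$, is $\phi$-consistent, then (E) holds; * conversely, if (E) holds, then each $q_y$, $y\in Y$, is $\phi$-consistent. -/

import Mathlib

open MeasureTheory
open scoped ComplexOrder

noncomputable section

namespace HypergroupExpectation

/-! ### `C(X) ⊗ C(X) = C(X × X)`, slice maps and tensor products of operators -/

section Tensor

variable {X Z : Type*} [TopologicalSpace X] [CompactSpace X] [T2Space X]
  [TopologicalSpace Z] [CompactSpace Z]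

/-- Pull-back `f ↦ f ∘ g` of continuous functions. -/
def pullback (g : C(X, Z)) : C(Z, ℂ) →L[ℂ] C(X, ℂ) where
  toFun f := f.comp g
  map_add' _ _ := rfl
  map_smul' _ _ := rfl
  cont := g.continuous_precomp

/-- `F ↦ (x ↦ F (x, ·))`. -/
def curryCLM : C(X × X, ℂ) →L[ℂ] C(X, C(X, ℂ)) where
  toFun F := F.curry
  map_add' _ _ := rfl
  map_smul' _ _ := rfl
  cont := ContinuousMap.continuous_curry

/-- Inverse of `curryCLM`. -/
def uncurryCLM : C(X, C(X, ℂ)) →L[ℂ] C(X × X, ℂ) where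
  toFun F := F.uncurry
  map_add' _ _ := rfl
  map_smul' _ _ := rfl
  cont := ContinuousMap.continuous_uncurry

/-- The flip of `C(X × X)`. -/
def flipCLM : C(X × X, ℂ) →L[ℂ] C(X × X, ℂ) :=
  pullback ⟨Prod.swap, continuous_swap⟩

/-- `id ⊗ η`, i.e. `F ↦ (x ↦ ⟨η, F (x, ·)⟩)`. -/
def idTensorFunctional (η : StrongDual ℂ C(X, ℂ)) : C(X × X, ℂ) →L[ℂ] C(X, ℂ) :=
  (η.compLeftContinuous ℂ X) ∘L curryCLM

/-- `ξ ⊗ id`, i.e. `F ↦ (y ↦ ⟨ξ, F (·, y)⟩)`. -/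
def functionalTensorId (ξ : StrongDual ℂ C(X, ℂ)) : C(X × X, ℂ) →L[ℂ] C(X, ℂ) :=
  idTensorFunctional ξ ∘L flipCLM

/-- `id ⊗ T`: the operator `T` applied to `F (x, ·)` for every `x`. -/
def idTensor (T : C(X, ℂ) →L[ℂ] C(X, ℂ)) : C(X × X, ℂ) →L[ℂ] C(X × X, ℂ) :=
  uncurryCLM ∘L (T.compLeftContinuous ℂ X) ∘L curryCLM

/-- `S ⊗ T = (S ⊗ id)(id ⊗ T)` on `C(X) ⊗ C(X) = C(X × X)`. -/
def tensor (S T : C(X, ℂ) →L[ℂ] C(X, ℂ)) : C(X × X, ℂ) →L[ℂ] C(X × X, ℂ) :=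
  flipCLM ∘L idTensor S ∘L flipCLM ∘L idTensor T

end Tensor

/-! ### Compact DJS-hypergroups -/

/-- A compact (Dunkl–Jewett–Spector) hypergroup structure on a compact Hausdorff space `Q`.
The convolution is given by the probability measures `conv x y = δ_x ∗ δ_y`; the axioms are
the usual ones, where on a compact space the cone topology on positive measures is the weak
topology against `C(Q)`, and the topology on the compact subsets of `Q` is generated by
the sets `{A | A ⊆ U}` and `{A | A ∩ U ≠ ∅}` for `U` open. -/
structure CompactHypergroup (Q : Type*) [TopologicalSpace Q] [CompactSpace Q] [T2Space Q]
    [MeasurableSpace Q] [BorelSpace Q] where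
  /-- `δ_x ∗ δ_y`. -/
  conv : Q → Q → Measure Q
  /-- The neutral element. -/
  e : Q
  /-- The involution `x ↦ x†`. -/
  dagger : Q → Q
  isProbabilityMeasure_conv : ∀ x y, IsProbabilityMeasure (conv x y)
  regular_conv : ∀ x y, (conv x y).Regular
  continuous_integral_conv : ∀ f : C(Q, ℂ),
    Continuous fun p : Q × Q => ∫ t, f t ∂(conv p.1 p.2)
  assoc : ∀ (x y z : Q) (f : C(Q, ℂ)),
    ∫ s, (∫ t, f t ∂(conv s z)) ∂(conv x y) = ∫ s, (∫ t, f t ∂(conv x s)) ∂(conv y z)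
  isOpen_support_subset : ∀ U : Set Q, IsOpen U →
    IsOpen {p : Q × Q | (conv p.1 p.2).support ⊆ U}
  isOpen_support_inter_nonempty : ∀ U : Set Q, IsOpen U →
    IsOpen {p : Q × Q | ((conv p.1 p.2).support ∩ U).Nonempty}
  conv_e : ∀ x, conv x e = Measure.dirac x
  e_conv : ∀ x, conv e x = Measure.dirac x
  continuous_dagger : Continuous dagger
  dagger_dagger : ∀ x, dagger (dagger x) = x
  map_dagger_conv : ∀ x y, (conv x y).map dagger = conv (dagger y) (dagger x)
  e_mem_support_iff : ∀ x y, e ∈ (conv x y).support ↔ x = dagger y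

variable {Q Y : Type*} [TopologicalSpace Q] [CompactSpace Q] [T2Space Q] [MeasurableSpace Q]
  [BorelSpace Q] [TopologicalSpace Y] [CompactSpace Y] [T2Space Y]

namespace CompactHypergroup

variable (H : CompactHypergroup Q)

/-- The comultiplication `Δ : C(Q) → C(Q) ⊗ C(Q) = C(Q × Q)`,
`(Δ f)(x, y) = ⟨δ_x ∗ δ_y, f⟩`. -/
def comul : C(Q, ℂ) →L[ℂ] C(Q × Q, ℂ) :=
  LinearMap.mkContinuous
    { toFun := fun f =>
        ⟨fun p => ∫ t, f t ∂(H.conv p.1 p.2), H.continuous_integral_conv f⟩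
      map_add' := fun f g => by
        ext p
        have := H.isProbabilityMeasure_conv p.1 p.2
        exact integral_add
          (f.continuous.integrable_of_hasCompactSupport (HasCompactSupport.of_compactSpace _))
          (g.continuous.integrable_of_hasCompactSupport (HasCompactSupport.of_compactSpace _))
      map_smul' := fun c f => by
        ext p
        exact integral_const_mul c _ }
    1 (fun f => by
      rw [one_mul, ContinuousMap.norm_le _ (norm_nonneg f)]
      intro p
      have := H.isProbabilityMeasure_conv p.1 p.2
      simpa using norm_integral_le_of_norm_le_const (μ := H.conv p.1 p.2)
        (Filter.Eventually.of_forall f.norm_coe_le_norm))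

/-- The counit `ε`, evaluation at the neutral element. -/
def counit : StrongDual ℂ C(Q, ℂ) := ContinuousMap.evalCLM ℂ H.e

/-- `f⋆(x) = conj (f (x†))`. -/
def starOp (f : C(Q, ℂ)) : C(Q, ℂ) := star (f.comp ⟨H.dagger, H.continuous_dagger⟩)

/-- Convolution of Radon measures, `⟨ξ ∗ η, f⟩ = ⟨ξ ⊗ η, Δ f⟩`. The space `M(Q)` of complex
Radon measures is the dual of `C(Q)`. -/
def convolution (ξ η : StrongDual ℂ C(Q, ℂ)) : StrongDual ℂ C(Q, ℂ) :=
  ξ ∘L idTensorFunctional η ∘L H.comul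

/-- `μ` is the normalized Haar measure: `(μ ⊗ id) Δ f = (id ⊗ μ) Δ f = ⟨μ, f⟩ 1`. -/
structure IsHaarMeasure (μ : Measure Q) : Prop where
  isProbabilityMeasure : IsProbabilityMeasure μ
  regular : μ.Regular
  left_invariant : ∀ (f : C(Q, ℂ)) (x : Q), ∫ y, H.comul f (x, y) ∂μ = ∫ y, f y ∂μ
  right_invariant : ∀ (f : C(Q, ℂ)) (x : Q), ∫ y, H.comul f (y, x) ∂μ = ∫ y, f y ∂μ

end CompactHypergroup

/-- A finite positive measure as an element of `M(Q)`, `⟨q, f⟩ = ∫ f dq`. -/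
def toFunctional (q : Measure Q) [IsFiniteMeasure q] : StrongDual ℂ C(Q, ℂ) :=
  LinearMap.mkContinuous
    { toFun := fun f => ∫ t, f t ∂q
      map_add' := fun f g => integral_add
          (f.continuous.integrable_of_hasCompactSupport (HasCompactSupport.of_compactSpace _))
          (g.continuous.integrable_of_hasCompactSupport (HasCompactSupport.of_compactSpace _))
      map_smul' := fun c f => integral_const_mul c _ }
    (q.real Set.univ) (fun f => by
      have := norm_integral_le_of_norm_le_const (μ := q)
        (Filter.Eventually.of_forall f.norm_coe_le_norm)
      simpa [mul_comm] using this)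

/-! ### Orbital maps -/

/-- An orbital map: an open continuous map of `Q` onto `Y`. -/
structure IsOrbitalMap (φ : C(Q, Y)) : Prop where
  isOpenMap : IsOpenMap φ
  surjective : Function.Surjective φ

/-- The `φ`-orbits are the fibres `φ⁻¹(y)`, `y ∈ Y`. -/
def IsOrbit (φ : C(Q, Y)) (A : Set Q) : Prop := ∃ y : Y, A = φ ⁻¹' {y}

/-- The `C*`-subalgebra `B` of `C(Q)` of functions that are constant on `φ`-orbits. -/
def orbitAlgebra (φ : C(Q, Y)) : StarSubalgebra ℂ C(Q, ℂ) where
  carrier := {f | ∀ x x' : Q, φ x = φ x' → f x = f x'}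
  mul_mem' hf hg x x' h := by simp [hf x x' h, hg x x' h]
  add_mem' hf hg x x' h := by simp [hf x x' h, hg x x' h]
  algebraMap_mem' _ _ _ _ := rfl
  star_mem' hf x x' h := by simp [hf x x' h]

/-- `φ_* : M(Q) → M(Y)`, `⟨φ_* ξ, f⟩ = ⟨ξ, f ∘ φ⟩`. -/
def pushforward (φ : C(Q, Y)) (ξ : StrongDual ℂ C(Q, ℂ)) : StrongDual ℂ C(Y, ℂ) :=
  ξ ∘L pullback φ

/-- `ξ` is `φ`-consistent: `φ_*(ξ ∗ ν) = 0 = φ_*(ν ∗ ξ)` whenever `φ_* ν = 0`. -/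
def IsConsistent (H : CompactHypergroup Q) (φ : C(Q, Y)) (ξ : StrongDual ℂ C(Q, ℂ)) : Prop :=
  ∀ ν : StrongDual ℂ C(Q, ℂ), pushforward φ ν = 0 →
    pushforward φ (H.convolution ξ ν) = 0 ∧ pushforward φ (H.convolution ν ξ) = 0

/-! ### Conditional expectations -/

/-- `P` is a conditional expectation of `C(Q)` onto `B`: a positive projection of norm at most
one onto `B` that is `B`-bilinear. -/
structure IsConditionalExpectation (B : StarSubalgebra ℂ C(Q, ℂ))
    (P : C(Q, ℂ) →L[ℂ] C(Q, ℂ)) : Prop where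
  mem : ∀ f, P f ∈ B
  apply_of_mem : ∀ b ∈ B, P b = b
  norm_le : ∀ f, ‖P f‖ ≤ ‖f‖
  nonneg : ∀ f : C(Q, ℂ), (∀ x, 0 ≤ f x) → ∀ x, 0 ≤ P f x
  bimodule : ∀ (f : C(Q, ℂ)), ∀ a ∈ B, ∀ b ∈ B, P (a * f * b) = a * P f * b

/-- The comultiplication `Δ̃ = (P ⊗ P) Δ` induced by `P`. -/
def inducedComul (H : CompactHypergroup Q) (P : C(Q, ℂ) →L[ℂ] C(Q, ℂ)) :
    C(Q, ℂ) →L[ℂ] C(Q × Q, ℂ) :=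
  tensor P P ∘L H.comul

/-- `P` is a `μ`-invariant conditional expectation of `C(Q)` onto the unital `C*`-subalgebra `B`
that satisfies the conditions under which `Δ̃ = (P ⊗ P) Δ` makes `B` a compact quantum hypergroup.
Here `A₀`, `A₀₂` are the distinguished dense subalgebras of `C(Q)` and `C(Q × Q)`, and `σ` is the
complex one-parameter group. -/
structure IsHypergroupExpectation (H : CompactHypergroup Q) (μ : Measure Q)
    (A₀ : Subalgebra ℂ C(Q, ℂ)) (A₀₂ : Subalgebra ℂ C(Q × Q, ℂ))
    (σ : ℂ → C(Q, ℂ) →ₗ[ℂ] C(Q, ℂ)) (B : StarSubalgebra ℂ C(Q, ℂ))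
    (P : C(Q, ℂ) →L[ℂ] C(Q, ℂ)) : Prop where
  isClosed : IsClosed (B : Set C(Q, ℂ))
  isConditionalExpectation : IsConditionalExpectation B P
  invariant : ∀ f, ∫ x, P f x ∂μ = ∫ x, f x ∂μ
  coideal : ∀ f, inducedComul H P f = inducedComul H P (P f)
  map_starOp : ∀ f, P (H.starOp f) = H.starOp (P f)
  map_mem : ∀ f ∈ A₀, P f ∈ A₀
  tensor_map_mem : ∀ F ∈ A₀₂, tensor P P F ∈ A₀₂
  map_modular : ∀ z, ∀ f ∈ A₀, P (σ z f) = σ z (P f)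
  counit_left : ∀ b ∈ B, functionalTensorId H.counit (inducedComul H P b) = b
  counit_right : ∀ b ∈ B, idTensorFunctional H.counit (inducedComul H P b) = b

/-- The instance of `IsHypergroupExpectation` for an ordinary compact hypergroup:
the one-parameter group is trivial, and the distinguished dense subalgebras are all of `C(Q)`
and `C(Q × Q)`. -/
def IsClassicalHypergroupExpectation (H : CompactHypergroup Q) (μ : Measure Q)
    (B : StarSubalgebra ℂ C(Q, ℂ)) (P : C(Q, ℂ) →L[ℂ] C(Q, ℂ)) : Prop :=
  IsHypergroupExpectation H μ ⊤ ⊤ (fun _ => LinearMap.id) B P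

end HypergroupExpectation

end

/-!
Write `B` for the algebra of functions constant on orbits, `b(x ∗ y) = (Δ b)(x, y)`, and `μ` for
Haar measure. Testing against `ν = δ_x - δ_{x'}` with `φ x = φ x'` shows that a measure `ξ` is
consistent exactly when `b(ξ ∗ ·)` (left consistency) and `b(· ∗ ξ)` (right consistency) belong to
`B` for every `b ∈ B`.

Both directions rest on approximate identities. By the axiom on `e ∈ supp (δ_x ∗ δ_y)` and
compactness, a function `u ≥ 0` supported near `e` has `u(x ∗ y)` supported near the antidiagonal
`y = x†`; by invariance `∫ u(x ∗ y) dμ(y) = μ(u)` for all `x`. So the measures `u(x ∗ ·) μ`,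
once normalized, tend to `δ_{x†}` uniformly in `x` (`IsHaarMeasure.exists_isOpen_norm_integral_le`).
Here `μ(u) > 0` because `μ` has full support (`IsHaarMeasure.eq_zero_of_integral_eq_zero`).

*Consistency implies the conditional expectation.* As `{e}` is an orbit, `u` can be taken in `B`,
hence the right translates `b(· ∗ x)`, `b ∈ B`, span a dense subspace of `C(Q)`
(`eq_top_of_rightTranslate_mem`). On such a function `⟨q_{φ(z)}, b(· ∗ x)⟩ = b(z ∗ q_{φ(x)})`,
which is continuous in `z`, so `P` maps into `C(Q)` (`continuous_integral_orbit`). Similarly,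
a left consistent measure is determined by its restriction to `B` (`IsLeftConsistent.ext`).
The invariance of `μ`, the coideal identity and the compatibility with the involution are all
equalities of two left consistent measures that visibly agree on `B`.

*The conditional expectation implies consistency.* Using approximate identities on both sides of
`∫ ∫ u(s ∗ z ∗ y) k(s†) g(y) dμ(s) dμ(y)`, the left translations by `z` and by `z†` are seen to be
adjoint in `L²(μ)` (`IsHaarMeasure.integral_comul_mul`). For `b ∈ B` and `h = b(q_y ∗ ·)` this
moves the translation from `b` to an arbitrary `g` in `∫ h g dμ`; invariance, bilinearity over `B`
and the coideal identity then give `∫ h g dμ = ∫ h P(g) dμ = ∫ P(h) g dμ`, so `h = P(h) ∈ B`.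
Right consistency follows by applying the involution.
-/

open MeasureTheory
open scoped ComplexOrder

noncomputable section

namespace HypergroupExpectation

/-! ### Integrals of continuous functions on a compact space -/

theorem integral_norm_eq_norm_integral {X : Type*} [MeasurableSpace X] {f : X → ℂ}
    (h0 : ∀ x, 0 ≤ f x) (ν : Measure X) :
    ∫ x, ‖f x‖ ∂ν = ‖∫ x, f x ∂ν‖ := by
  have h : ∀ x, f x = ((‖f x‖ : ℝ) : ℂ) := fun x => (RCLike.norm_of_nonneg' (h0 x)).symm
  have h2 : ∫ x, f x ∂ν = ((∫ x, ‖f x‖ ∂ν : ℝ) : ℂ) := by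
    rw [← integral_complex_ofReal]; exact integral_congr_ae (Filter.Eventually.of_forall h)
  rw [h2, Complex.norm_real, Real.norm_of_nonneg (integral_nonneg fun _ => norm_nonneg _)]

theorem integral_complex_nonneg {X : Type*} [MeasurableSpace X] {f : X → ℂ}
    (ν : Measure X) (h0 : ∀ᵐ x ∂ν, 0 ≤ f x) :
    0 ≤ ∫ x, f x ∂ν := by
  have h2 : ∫ x, f x ∂ν = ((∫ x, ‖f x‖ ∂ν : ℝ) : ℂ) := by
    rw [← integral_complex_ofReal]
    exact integral_congr_ae (h0.mono fun x hx => (RCLike.norm_of_nonneg' hx).symm)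
  rw [h2, Complex.zero_le_real]
  exact integral_nonneg fun _ => norm_nonneg _

section Integral

variable {X : Type*} [TopologicalSpace X] [CompactSpace X] [MeasurableSpace X] [BorelSpace X]

theorem integrable_of_continuous {E : Type*} [NormedAddCommGroup E] {f : X → E}
    (hf : Continuous f) (ν : Measure X) [IsFiniteMeasure ν] : Integrable f ν :=
  hf.integrable_of_hasCompactSupport (HasCompactSupport.of_compactSpace _)

theorem eq_zero_on_support_of_integral_eq_zero {f : X → ℂ} (hf : Continuous f)
    (h0 : ∀ x, 0 ≤ f x) (ν : Measure X) [IsFiniteMeasure ν] (h : ∫ x, f x ∂ν = 0) :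
    ∀ x ∈ ν.support, f x = 0 := by
  have h1 := integral_norm_eq_norm_integral h0 ν
  rw [h, norm_zero, integral_eq_zero_iff_of_nonneg (fun _ => norm_nonneg _)
    (integrable_of_continuous hf ν).norm] at h1
  intro x hx
  by_contra hne
  have hU : {y | f y ≠ 0} ∈ nhds x := (isOpen_ne.preimage hf).mem_nhds hne
  refine ((Measure.mem_support_iff_forall x).1 hx _ hU).ne' ?_
  have h2 : ∀ᵐ y ∂ν, f y = 0 := h1.mono fun y hy => by simpa using hy
  exact ae_iff.1 h2

theorem toFunctional_apply (q : Measure X) [IsFiniteMeasure q] (f : C(X, ℂ)) :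
    toFunctional q f = ∫ t, f t ∂q := rfl

theorem norm_toFunctional_le (p : Measure X) [IsProbabilityMeasure p] (f : C(X, ℂ)) :
    ‖toFunctional p f‖ ≤ ‖f‖ := by
  rw [toFunctional_apply]
  simpa using norm_integral_le_of_norm_le_const (μ := p)
    (Filter.Eventually.of_forall f.norm_coe_le_norm)

theorem toFunctional_congr {q : Measure X} [IsFiniteMeasure q] [q.Regular] {f g : C(X, ℂ)}
    (h : ∀ x ∈ q.support, f x = g x) : toFunctional q f = toFunctional q g :=
  integral_congr_ae (Filter.mem_of_superset Measure.support_mem_ae_of_regular h)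

theorem toFunctional_eq_of_const {q : Measure X} [IsProbabilityMeasure q] [q.Regular]
    {f : C(X, ℂ)} {c : ℂ} (h : ∀ x ∈ q.support, f x = c) : toFunctional q f = c := by
  rw [toFunctional_congr (g := ContinuousMap.const X c) h, toFunctional_apply]
  simp

variable [T2Space X]

/-- A Fubini theorem for a positive measure `q` and an arbitrary complex Radon measure `ξ`:
`(ξ ⊗ q)(F)` may be computed in either order. On a compact Hausdorff space without
countability assumptions it comes from the Bochner integral of `y ↦ F(·, y)` in `C(X)`. -/
theorem toFunctional_functionalTensorId (q : Measure X) [IsFiniteMeasure q]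
    (ξ : StrongDual ℂ C(X, ℂ)) (F : C(X × X, ℂ)) :
    toFunctional q (functionalTensorId ξ F) = ξ (idTensorFunctional (toFunctional q) F) := by
  have hint : Integrable (fun y => (flipCLM F).curry y) q :=
    integrable_of_continuous (flipCLM F).curry.continuous q
  have h1 : toFunctional q (functionalTensorId ξ F) = ξ (∫ y, (flipCLM F).curry y ∂q) :=
    ξ.integral_comp_comm hint
  rw [h1]
  congr 1
  ext x
  exact ((ContinuousMap.evalCLM ℂ x).integral_comp_comm hint).symm

end Integral

variable {Q Y : Type*} [TopologicalSpace Q] [CompactSpace Q] [T2Space Q] [MeasurableSpace Q]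
  [BorelSpace Q] [TopologicalSpace Y]

/-! ### Translations, the involution and Haar measure -/

namespace CompactHypergroup

variable (H : CompactHypergroup Q)

theorem comul_apply (f : C(Q, ℂ)) (x y : Q) : H.comul f (x, y) = ∫ t, f t ∂(H.conv x y) := rfl

/-- The left translate `y ↦ f(x ∗ y)`. -/
def leftTranslate (x : Q) (f : C(Q, ℂ)) : C(Q, ℂ) := (H.comul f).curry x

/-- The right translate `x ↦ f(x ∗ y)`. -/
def rightTranslate (y : Q) (f : C(Q, ℂ)) : C(Q, ℂ) := (flipCLM (H.comul f)).curry y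

theorem leftTranslate_apply (x y : Q) (f : C(Q, ℂ)) :
    H.leftTranslate x f y = H.comul f (x, y) := rfl

theorem rightTranslate_apply (x y : Q) (f : C(Q, ℂ)) :
    H.rightTranslate y f x = H.comul f (x, y) := rfl

theorem functionalTensorId_comul_apply (ξ : StrongDual ℂ C(Q, ℂ)) (f : C(Q, ℂ)) (y : Q) :
    functionalTensorId ξ (H.comul f) y = ξ (H.rightTranslate y f) := rfl

theorem comul_e_left (f : C(Q, ℂ)) (x : Q) : H.comul f (H.e, x) = f x := by
  rw [comul_apply, H.e_conv, integral_dirac]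

theorem comul_e_right (f : C(Q, ℂ)) (x : Q) : H.comul f (x, H.e) = f x := by
  rw [comul_apply, H.conv_e, integral_dirac]

theorem comul_eq_of_const {f : C(Q, ℂ)} {x y : Q} {c : ℂ}
    (h : ∀ t ∈ (H.conv x y).support, f t = c) : H.comul f (x, y) = c := by
  have := H.isProbabilityMeasure_conv x y
  have := H.regular_conv x y
  exact toFunctional_eq_of_const h

theorem comul_nonneg {f : C(Q, ℂ)} (hf : ∀ x, 0 ≤ f x) (p : Q × Q) : 0 ≤ H.comul f p :=
  integral_complex_nonneg _ (Filter.Eventually.of_forall hf)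

/-- Associativity against a measure `ξ` in the first slot: `f(ξ ∗ (t ∗ w)) = f((ξ ∗ t) ∗ w)`. -/
theorem comul_functionalTensorId_comul (ξ : StrongDual ℂ C(Q, ℂ)) (f : C(Q, ℂ)) (t w : Q) :
    H.comul (functionalTensorId ξ (H.comul f)) (t, w) =
      functionalTensorId ξ (H.comul (H.rightTranslate w f)) t := by
  have := H.isProbabilityMeasure_conv t w
  have h := toFunctional_functionalTensorId (H.conv t w) ξ (H.comul f)
  refine h.trans ?_
  rw [functionalTensorId_comul_apply]
  congr 1
  ext s
  exact (H.assoc s t w f).symm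

/-- The reflected function `x ↦ f(x†)`, so that `f⋆` is the complex conjugate of `reflect f`. -/
def reflect (f : C(Q, ℂ)) : C(Q, ℂ) := f.comp ⟨H.dagger, H.continuous_dagger⟩

theorem reflect_apply (f : C(Q, ℂ)) (x : Q) : H.reflect f x = f (H.dagger x) := rfl

theorem starOp_eq (f : C(Q, ℂ)) : H.starOp f = star (H.reflect f) := rfl

theorem comul_reflect (f : C(Q, ℂ)) (x y : Q) :
    H.comul (H.reflect f) (x, y) = H.comul f (H.dagger y, H.dagger x) := by
  rw [comul_apply, comul_apply, ← H.map_dagger_conv,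
    integral_map H.continuous_dagger.measurable.aemeasurable
      f.continuous.aestronglyMeasurable_of_compactSpace]
  rfl

variable {H} {μ : Measure Q}

theorem IsHaarMeasure.integral_reflect (hμ : H.IsHaarMeasure μ) (f : C(Q, ℂ)) :
    ∫ x, H.reflect f x ∂μ = ∫ x, f x ∂μ := by
  have := hμ.isProbabilityMeasure
  -- both sides equal the integral of `f(y ∗ x†)` with respect to `μ ⊗ μ`
  have h := toFunctional_functionalTensorId μ (toFunctional μ)
    ((H.comul f).comp ⟨fun p : Q × Q => (p.1, H.dagger p.2),
      continuous_fst.prodMk (H.continuous_dagger.comp continuous_snd)⟩)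
  have h1 : functionalTensorId (toFunctional μ)
      ((H.comul f).comp ⟨fun p : Q × Q => (p.1, H.dagger p.2),
        continuous_fst.prodMk (H.continuous_dagger.comp continuous_snd)⟩) =
      ContinuousMap.const Q (∫ x, f x ∂μ) := by
    ext x
    exact hμ.right_invariant f (H.dagger x)
  have h2 : idTensorFunctional (toFunctional μ)
      ((H.comul f).comp ⟨fun p : Q × Q => (p.1, H.dagger p.2),
        continuous_fst.prodMk (H.continuous_dagger.comp continuous_snd)⟩) =
      ContinuousMap.const Q (∫ x, H.reflect f x ∂μ) := by
    ext x
    refine Eq.trans ?_ (hμ.right_invariant (H.reflect f) (H.dagger x))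
    refine integral_congr_ae (Filter.Eventually.of_forall fun y => ?_)
    simp only [comul_reflect, H.dagger_dagger]
    rfl
  rw [h1, h2] at h
  simpa [toFunctional_apply] using h.symm

/-- Haar measure has full support. If `μ(f) = 0` with `f ≥ 0`, pick `y ∈ supp μ`; invariance
gives `f(y† ∗ y) = 0`, and `e ∈ supp (δ_{y†} ∗ δ_y)` gives `f(e) = 0`. Translates of `f` have
integral zero too, so `f` vanishes everywhere. -/
theorem IsHaarMeasure.eq_zero_of_integral_eq_zero (hμ : H.IsHaarMeasure μ) {f : C(Q, ℂ)}
    (h0 : ∀ x, 0 ≤ f x) (h : ∫ x, f x ∂μ = 0) : f = 0 := by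
  have := hμ.isProbabilityMeasure
  have := hμ.regular
  obtain ⟨y, hy⟩ : μ.support.Nonempty := by
    by_contra hne
    have h1 := Measure.measure_compl_support_of_regular (μ := μ)
    rw [Set.not_nonempty_iff_eq_empty.1 hne] at h1
    simp at h1
  have he : ∀ g : C(Q, ℂ), (∀ x, 0 ≤ g x) → ∫ x, g x ∂μ = 0 → g H.e = 0 := by
    intro g hg0 hg
    have := H.isProbabilityMeasure_conv (H.dagger y) y
    have h1 : H.comul g (H.dagger y, y) = 0 :=
      eq_zero_on_support_of_integral_eq_zero (H.leftTranslate (H.dagger y) g).continuous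
        (fun x => H.comul_nonneg hg0 _) μ ((hμ.left_invariant g _).trans hg) y hy
    exact eq_zero_on_support_of_integral_eq_zero g.continuous hg0 _ h1 _
      ((H.e_mem_support_iff _ _).2 rfl)
  ext x
  have h1 := he (H.leftTranslate x f) (fun t => H.comul_nonneg h0 _)
    ((hμ.left_invariant f x).trans h)
  rwa [leftTranslate_apply, comul_e_right] at h1

end CompactHypergroup

/-! ### Approximate identities -/

namespace CompactHypergroup

variable (H : CompactHypergroup Q)

/-- If `f` lives close to `e`, then `(x, y) ↦ f(x ∗ y)` lives close to the antidiagonal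
`{(x, x†)}`, because `e ∈ supp (δ_x ∗ δ_y)` only for `y = x†` and the support depends upper
semicontinuously on `(x, y)`. -/
theorem exists_isOpen_comul_eq_zero {W : Set (Q × Q)} (hW : IsOpen W)
    (hd : ∀ x, (x, H.dagger x) ∈ W) :
    ∃ U : Set Q, IsOpen U ∧ H.e ∈ U ∧
      ∀ f : C(Q, ℂ), (∀ x ∉ U, f x = 0) → ∀ p ∉ W, H.comul f p = 0 := by
  obtain ⟨U, hU, heU, h⟩ : ∃ U : Set Q, IsOpen U ∧ H.e ∈ U ∧
      ∀ p ∈ Wᶜ, (H.conv p.1 p.2).support ⊆ Uᶜ := by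
    refine hW.isClosed_compl.isCompact.induction_on
      (p := fun S => ∃ U : Set Q, IsOpen U ∧ H.e ∈ U ∧
        ∀ p ∈ S, (H.conv p.1 p.2).support ⊆ Uᶜ) ⟨Set.univ, isOpen_univ, trivial, by simp⟩
      ?_ ?_ ?_
    · rintro S T hST ⟨U, hU, heU, h⟩
      exact ⟨U, hU, heU, fun p hp => h p (hST hp)⟩
    · rintro S T ⟨U, hU, heU, h⟩ ⟨V, hV, heV, h'⟩
      refine ⟨U ∩ V, hU.inter hV, ⟨heU, heV⟩, ?_⟩
      rintro p (hp | hp)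
      · exact (h p hp).trans (Set.compl_subset_compl.2 Set.inter_subset_left)
      · exact (h' p hp).trans (Set.compl_subset_compl.2 Set.inter_subset_right)
    · intro p hp
      have hep : H.e ∉ (H.conv p.1 p.2).support := by
        rw [H.e_mem_support_iff]
        intro hpe
        apply hp
        have := hd p.1
        rwa [hpe, H.dagger_dagger, ← hpe] at this
      obtain ⟨V, U, hV, hU, hpV, heU, hUV⟩ := SeparatedNhds.of_isCompact_isCompact
        (Measure.isClosed_support (μ := H.conv p.1 p.2)).isCompact
        (isCompact_singleton (x := H.e)) (Set.disjoint_singleton_right.2 hep)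
      refine ⟨{p | (H.conv p.1 p.2).support ⊆ V},
        mem_nhdsWithin_of_mem_nhds ((H.isOpen_support_subset V hV).mem_nhds hpV),
        U, hU, heU rfl, fun p' hp' => hp'.trans hUV.subset_compl_right⟩
  refine ⟨U, hU, heU, fun f hf p hp => ?_⟩
  exact H.comul_eq_of_const fun t ht => hf t (h p hp ht)

variable {H} {μ : Measure Q}

/-- For `u ≥ 0` supported near `e`, the measures `u(x ∗ ·) μ` and `u(· ∗ x) μ`, which have total
mass `μ(u)` by invariance, concentrate at `x†`, uniformly in `x`. -/
theorem IsHaarMeasure.exists_isOpen_norm_integral_le (hμ : H.IsHaarMeasure μ)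
    {G : C(Q × Q, ℂ)} (hG : ∀ x, G (x, H.dagger x) = 0) {ε : ℝ} (hε : 0 < ε) :
    ∃ U : Set Q, IsOpen U ∧ H.e ∈ U ∧
      ∀ u : C(Q, ℂ), (∀ x, 0 ≤ u x) → (∀ x ∉ U, u x = 0) → ∀ x,
        ‖∫ y, H.comul u (x, y) * G (x, y) ∂μ‖ ≤ ε * ‖∫ y, u y ∂μ‖ ∧
        ‖∫ y, H.comul u (y, x) * G (y, x) ∂μ‖ ≤ ε * ‖∫ y, u y ∂μ‖ := by
  have := hμ.isProbabilityMeasure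
  obtain ⟨U, hU, heU, h⟩ := H.exists_isOpen_comul_eq_zero (W := {p | ‖G p‖ < ε})
    (isOpen_lt G.continuous.norm continuous_const) (fun x => by simpa [hG x] using hε)
  refine ⟨U, hU, heU, fun u hu huU x => ?_⟩
  have hb : ∀ p, ‖H.comul u p * G p‖ ≤ ε * ‖H.comul u p‖ := by
    intro p
    by_cases hp : ‖G p‖ < ε
    · rw [norm_mul, mul_comm]; gcongr
    · simp [h u huU p hp]
  constructor
  · refine (norm_integral_le_of_norm_le
      ((integrable_of_continuous (H.leftTranslate x u).continuous μ).norm.const_mul ε)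
      (Filter.Eventually.of_forall fun y => hb (x, y))).trans_eq ?_
    rw [integral_const_mul, integral_norm_eq_norm_integral (f := H.leftTranslate x u)
      fun y => H.comul_nonneg hu _]
    exact congrArg (fun c => ε * ‖c‖) (hμ.left_invariant u x)
  · refine (norm_integral_le_of_norm_le
      ((integrable_of_continuous (H.rightTranslate x u).continuous μ).norm.const_mul ε)
      (Filter.Eventually.of_forall fun y => hb (y, x))).trans_eq ?_
    rw [integral_const_mul, integral_norm_eq_norm_integral (f := H.rightTranslate x u)
      fun y => H.comul_nonneg hu _]
    exact congrArg (fun c => ε * ‖c‖) (hμ.right_invariant u x)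

end CompactHypergroup

/-- There are nonnegative functions in `B`, supported in a given neighbourhood of `e`, with value
`1` at `e`: since `{e}` is an orbit, they can be pulled back from `Y`. -/
theorem exists_mem_orbitAlgebra_bump {Q Y : Type*} [TopologicalSpace Q] [CompactSpace Q]
    [TopologicalSpace Y] [CompactSpace Y] [T2Space Y] {e : Q} {φ : C(Q, Y)} (ha : φ ⁻¹' {φ e} = {e})
    {U : Set Q} (hU : IsOpen U) (heU : e ∈ U) :
    ∃ u ∈ orbitAlgebra φ, (∀ x, 0 ≤ u x) ∧ (∀ x ∉ U, u x = 0) ∧ u e = 1 := by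
  have hd : Disjoint (φ '' Uᶜ) {φ e} := by
    rw [Set.disjoint_singleton_right]
    rintro ⟨x, hx, hxe⟩
    have : x ∈ φ ⁻¹' {φ e} := hxe
    rw [ha] at this
    exact hx (this ▸ heU)
  obtain ⟨f, hf0, hf1, hf⟩ := exists_continuous_zero_one_of_isClosed
    (hU.isClosed_compl.isCompact.image φ.continuous).isClosed isClosed_singleton hd
  refine ⟨⟨fun x => (f (φ x) : ℂ), by fun_prop⟩, fun x x' h => ?_, fun x => ?_, fun x hx => ?_, ?_⟩
  · simp [h]
  · simpa using (hf (φ x)).1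
  · simpa using hf0 ⟨x, hx, rfl⟩
  · simpa using hf1 rfl

/-- The right translates of functions in `B` span a dense subspace of `C(Q)`: for `u ∈ B` close to
`δ_e`, the averages `∫ g(x) u(· ∗ x) dμ(x)` are close to `g(·†)`. -/
theorem eq_top_of_rightTranslate_mem [CompactSpace Y] [T2Space Y] {H : CompactHypergroup Q}
    {μ : Measure Q} (hμ : H.IsHaarMeasure μ) {φ : C(Q, Y)} (ha : φ ⁻¹' {φ H.e} = {H.e})
    {S : Submodule ℂ C(Q, ℂ)} (hS : IsClosed (S : Set C(Q, ℂ)))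
    (h : ∀ b ∈ orbitAlgebra φ, ∀ x, H.rightTranslate x b ∈ S) : S = ⊤ := by
  have := hμ.isProbabilityMeasure
  rw [Submodule.eq_top_iff']
  intro f
  rw [← SetLike.mem_coe, ← hS.closure_eq, Metric.mem_closure_iff]
  intro ε hε
  let g : C(Q, ℂ) := H.reflect f
  obtain ⟨U, hU, heU, hb⟩ := hμ.exists_isOpen_norm_integral_le
    (G := ⟨fun p => g p.2 - f p.1, by fun_prop⟩)
    (fun x => by simp [g, H.reflect_apply, H.dagger_dagger]) (half_pos hε)
  obtain ⟨u, huB, hu0, huU, hue⟩ := exists_mem_orbitAlgebra_bump ha hU heU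
  set c := ∫ y, u y ∂μ with hc
  have hc0 : c ≠ 0 := fun h0 => by
    have := hμ.eq_zero_of_integral_eq_zero hu0 h0
    rw [this] at hue
    simp at hue
  have hcont : Continuous fun x => g x • H.rightTranslate x u :=
    g.continuous.smul (flipCLM (H.comul u)).curry.continuous
  have hint := integrable_of_continuous hcont μ
  refine ⟨c⁻¹ • ∫ x, g x • H.rightTranslate x u ∂μ, S.smul_mem _ ?_, ?_⟩
  · exact (S.restrictScalars ℝ).convex.integral_mem hS
      (Filter.Eventually.of_forall fun x => S.smul_mem _ (h u huB x)) hint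
  · refine lt_of_le_of_lt ?_ (half_lt_self hε)
    rw [dist_comm, dist_eq_norm, ContinuousMap.norm_le _ (half_pos hε).le]
    intro z
    have h1 : (∫ x, g x • H.rightTranslate x u ∂μ) z = ∫ x, H.comul u (z, x) * g x ∂μ := by
      refine ((ContinuousMap.evalCLM ℂ z).integral_comp_comm hint).symm.trans ?_
      refine integral_congr_ae (Filter.Eventually.of_forall fun x => ?_)
      simp [H.rightTranslate_apply, mul_comm]
    have h2 : ∫ x, H.comul u (z, x) * (g x - f z) ∂μ =
        ∫ x, H.comul u (z, x) * g x ∂μ - c * f z := by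
      have h3 := hμ.left_invariant u z
      rw [← hc] at h3
      simp_rw [mul_sub]
      rw [integral_sub, integral_mul_const, h3]
      · exact integrable_of_continuous (by fun_prop) μ
      · exact integrable_of_continuous (by fun_prop) μ
    have h4 := (hb u hu0 huU z).1
    simp only [ContinuousMap.coe_mk] at h4
    rw [h2, ← hc] at h4
    have h5 : (c⁻¹ • (∫ x, g x • H.rightTranslate x u ∂μ) - f) z =
        c⁻¹ * (∫ x, H.comul u (z, x) * g x ∂μ - c * f z) := by
      rw [ContinuousMap.sub_apply, ContinuousMap.smul_apply, h1, smul_eq_mul]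
      field_simp
    rw [h5, norm_mul, norm_inv, inv_mul_le_iff₀ (norm_pos_iff.2 hc0)]
    linarith

/-! ### Consistent measures -/

theorem IsOrbitalMap.exists_pullback_eq {Q Y : Type*} [TopologicalSpace Q] [CompactSpace Q]
    [T2Space Q] [TopologicalSpace Y] [CompactSpace Y] {φ : C(Q, Y)} (hφ : IsOrbitalMap φ)
    {b : C(Q, ℂ)} (hb : b ∈ orbitAlgebra φ) : ∃ g : C(Y, ℂ), pullback φ g = b := by
  have h : Topology.IsQuotientMap φ :=
    hφ.isOpenMap.isQuotientMap φ.continuous hφ.surjective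
  exact ⟨h.lift b fun x x' hx => hb x x' hx, h.lift_comp b fun x x' hx => hb x x' hx⟩

theorem pullback_mem_orbitAlgebra {Q Y : Type*} [TopologicalSpace Q] [CompactSpace Q]
    [T2Space Q] [TopologicalSpace Y] [CompactSpace Y] (φ : C(Q, Y)) (g : C(Y, ℂ)) :
    pullback φ g ∈ orbitAlgebra φ :=
  fun _ _ h => congrArg g h

theorem isClosed_orbitAlgebra {Q Y : Type*} [TopologicalSpace Q] [CompactSpace Q]
    [TopologicalSpace Y] [CompactSpace Y] (φ : C(Q, Y)) :
    IsClosed (orbitAlgebra φ : Set C(Q, ℂ)) := by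
  have : (orbitAlgebra φ : Set C(Q, ℂ)) =
      ⋂ x : Q, ⋂ x' : Q, ⋂ _ : φ x = φ x', {f : C(Q, ℂ) | f x = f x'} := by
    ext f
    simp only [Set.mem_iInter]
    rfl
  rw [this]
  exact isClosed_iInter fun x => isClosed_iInter fun x' => isClosed_iInter fun _ =>
    isClosed_eq (continuous_eval_const x) (continuous_eval_const x')

/-- `ξ` is left consistent if `y ↦ b(ξ ∗ y)` is constant on orbits for every `b ∈ B`; equivalently,
`φ_*(ξ ∗ ν) = 0` whenever `φ_* ν = 0`. -/
def IsLeftConsistent (H : CompactHypergroup Q) (φ : C(Q, Y)) (ξ : StrongDual ℂ C(Q, ℂ)) : Prop :=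
  ∀ b ∈ orbitAlgebra φ, functionalTensorId ξ (H.comul b) ∈ orbitAlgebra φ

/-- `ξ` is right consistent if `x ↦ b(x ∗ ξ)` is constant on orbits for every `b ∈ B`;
equivalently, `φ_*(ν ∗ ξ) = 0` whenever `φ_* ν = 0`. -/
def IsRightConsistent (H : CompactHypergroup Q) (φ : C(Q, Y)) (ξ : StrongDual ℂ C(Q, ℂ)) :
    Prop :=
  ∀ b ∈ orbitAlgebra φ, idTensorFunctional ξ (H.comul b) ∈ orbitAlgebra φ

variable {H : CompactHypergroup Q} {φ : C(Q, Y)}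

/-- Test consistency against the measures `δ_x - δ_{x'}` with `φ x = φ x'`. -/
theorem IsConsistent.isLeftConsistent_and_isRightConsistent [CompactSpace Y] (hφ : IsOrbitalMap φ)
    {ξ : StrongDual ℂ C(Q, ℂ)} (h : IsConsistent H φ ξ) :
    IsLeftConsistent H φ ξ ∧ IsRightConsistent H φ ξ := by
  have key : ∀ b ∈ orbitAlgebra φ, ∀ x x', φ x = φ x' →
      functionalTensorId ξ (H.comul b) x = functionalTensorId ξ (H.comul b) x' ∧
      idTensorFunctional ξ (H.comul b) x = idTensorFunctional ξ (H.comul b) x' := by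
    intro b hb x x' hx
    obtain ⟨g, rfl⟩ := hφ.exists_pullback_eq hb
    obtain ⟨h1, h2⟩ := h (ContinuousMap.evalCLM ℂ x - ContinuousMap.evalCLM ℂ x') (by
      ext f
      exact sub_eq_zero.2 (congrArg f hx))
    refine ⟨?_, sub_eq_zero.1 (DFunLike.congr_fun h2 g)⟩
    rw [← sub_eq_zero, H.functionalTensorId_comul_apply, H.functionalTensorId_comul_apply,
      ← map_sub]
    exact DFunLike.congr_fun h1 g
  exact ⟨fun b hb x x' hx => (key b hb x x' hx).1, fun b hb x x' hx => (key b hb x x' hx).2⟩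

theorem isConsistent_toFunctional [CompactSpace Y] (hφ : IsOrbitalMap φ) {q : Measure Q}
    [IsFiniteMeasure q] (hl : IsLeftConsistent H φ (toFunctional q))
    (hr : IsRightConsistent H φ (toFunctional q)) :
    IsConsistent H φ (toFunctional q) := by
  intro ν hν
  have hB : ∀ b ∈ orbitAlgebra φ, ν b = 0 := by
    intro b hb
    obtain ⟨g, rfl⟩ := hφ.exists_pullback_eq hb
    exact DFunLike.congr_fun hν g
  constructor
  · ext g
    have hb := pullback_mem_orbitAlgebra φ g
    -- exchange the order of `q` and `ν` by passing to the flipped function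
    have h := toFunctional_functionalTensorId q ν (flipCLM (H.comul (pullback φ g)))
    exact h.trans (hB _ (hl _ hb))
  · ext g
    exact hB _ (hr _ (pullback_mem_orbitAlgebra φ g))

theorem reflect_mem_orbitAlgebra
    (hb : ∀ A : Set Q, IsOrbit φ A → IsOrbit φ (H.dagger '' A)) {b : C(Q, ℂ)}
    (h : b ∈ orbitAlgebra φ) : H.reflect b ∈ orbitAlgebra φ := by
  intro x x' hx
  obtain ⟨y, hy⟩ := hb _ ⟨φ x, rfl⟩
  have h1 : H.dagger x ∈ H.dagger '' (φ ⁻¹' {φ x}) := ⟨x, rfl, rfl⟩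
  have h2 : H.dagger x' ∈ H.dagger '' (φ ⁻¹' {φ x}) := ⟨x', hx.symm, rfl⟩
  rw [hy] at h1 h2
  exact h _ _ (h1.trans h2.symm)

/-- `ξ ∗ q` is left consistent if `ξ` and `q` are. -/
theorem IsLeftConsistent.convolution {ξ : StrongDual ℂ C(Q, ℂ)} (hξ : IsLeftConsistent H φ ξ)
    {q : Measure Q} [IsFiniteMeasure q] (hq : IsLeftConsistent H φ (toFunctional q)) :
    IsLeftConsistent H φ (H.convolution ξ (toFunctional q)) := by
  intro b hb
  suffices heq : functionalTensorId (H.convolution ξ (toFunctional q)) (H.comul b) =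
      functionalTensorId (toFunctional q) (H.comul (functionalTensorId ξ (H.comul b))) by
    rw [heq]
    exact hq _ (hξ b hb)
  ext w
  have h := toFunctional_functionalTensorId q ξ (H.comul (H.rightTranslate w b))
  refine h.symm.trans ?_
  rw [H.functionalTensorId_comul_apply]
  congr 1
  ext t
  exact (H.comul_functionalTensorId_comul ξ b t w).symm

theorem inducedComul_apply {q : Y → Measure Q} [∀ y, IsProbabilityMeasure (q y)]
    {P : C(Q, ℂ) →L[ℂ] C(Q, ℂ)}
    (hP : ∀ f x, P f x = toFunctional (q (φ x)) f) (f : C(Q, ℂ)) (x y : Q) :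
    inducedComul H P f (x, y) =
      H.convolution (toFunctional (q (φ x))) (toFunctional (q (φ y))) f := by
  refine (hP _ x).trans ?_
  refine congrArg (toFunctional (q (φ x))) ?_
  ext z
  exact hP _ y

/-! ### Families of measures carried by the orbits -/

theorem toFunctional_orbit_eq {Q Y : Type*} [TopologicalSpace Q] [CompactSpace Q]
    [MeasurableSpace Q] [BorelSpace Q] [TopologicalSpace Y] {φ : C(Q, Y)} {q : Y → Measure Q}
    [∀ y, IsProbabilityMeasure (q y)] [∀ y, (q y).Regular]
    (hc : ∀ y, (q y).support ⊆ φ ⁻¹' {y}) {b : C(Q, ℂ)}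
    (hb : b ∈ orbitAlgebra φ) (x : Q) : toFunctional (q (φ x)) b = b x :=
  toFunctional_eq_of_const fun t ht => hb t x (hc _ ht)

section Family

variable {q : Y → Measure Q} [∀ y, IsProbabilityMeasure (q y)] [∀ y, (q y).Regular]

theorem toFunctional_counit (ha : φ ⁻¹' {φ H.e} = {H.e})
    (hc : ∀ y, (q y).support ⊆ φ ⁻¹' {y}) (f : C(Q, ℂ)) :
    toFunctional (q (φ H.e)) f = f H.e :=
  toFunctional_eq_of_const fun t ht => by
    have h := hc _ ht
    rw [ha] at h
    rw [Set.mem_singleton_iff.1 h]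

variable {μ : Measure Q}

/-- A left consistent measure is determined by its values on `B`, in the presence of a right
consistent probability measure on each orbit. Indeed, for `b ∈ B`,
`b(ξ ∗ x) = b(ξ ∗ q_{φ(x)})`, which is the value of `ξ` on the function `b(· ∗ q_{φ(x)})` of `B`;
and the functions `b(· ∗ x)` span a dense subspace. -/
theorem IsLeftConsistent.ext [CompactSpace Y] [T2Space Y] (hμ : H.IsHaarMeasure μ)
    (ha : φ ⁻¹' {φ H.e} = {H.e}) (hc : ∀ y, (q y).support ⊆ φ ⁻¹' {y})
    (hr : ∀ y, IsRightConsistent H φ (toFunctional (q y))) {ξ ξ' : StrongDual ℂ C(Q, ℂ)}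
    (hξ : IsLeftConsistent H φ ξ) (hξ' : IsLeftConsistent H φ ξ')
    (h : ∀ b ∈ orbitAlgebra φ, ξ b = ξ' b) : ξ = ξ' := by
  have key : ∀ η : StrongDual ℂ C(Q, ℂ), IsLeftConsistent H φ η → ∀ b ∈ orbitAlgebra φ, ∀ x,
      η (H.rightTranslate x b) =
        η (idTensorFunctional (toFunctional (q (φ x))) (H.comul b)) := fun η hη b hb x => by
    rw [← toFunctional_functionalTensorId, toFunctional_orbit_eq hc (hη b hb),
      H.functionalTensorId_comul_apply]
  have hS := eq_top_of_rightTranslate_mem hμ ha (S := (ξ - ξ').ker)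
    (ξ - ξ').isClosed_ker fun b hb x => by
      rw [LinearMap.mem_ker]
      refine sub_eq_zero.2 ((key ξ hξ b hb x).trans (Eq.trans ?_ (key ξ' hξ' b hb x).symm))
      exact h _ (hr _ b hb)
  ext f
  have hf : f ∈ (ξ - ξ').ker := hS ▸ Submodule.mem_top
  exact sub_eq_zero.1 hf

/-- For `f = b(· ∗ x)` with `b ∈ B`, consistency of `q_{φ(z)}` and of `q_{φ(x)}` gives
`⟨q_{φ(z)}, f⟩ = b(z ∗ q_{φ(x)})`, which is continuous in `z`; such `f` span a dense subspace. -/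
theorem continuous_integral_orbit [CompactSpace Y] [T2Space Y] (hμ : H.IsHaarMeasure μ)
    (ha : φ ⁻¹' {φ H.e} = {H.e})
    (hc : ∀ y, (q y).support ⊆ φ ⁻¹' {y})
    (hl : ∀ y, IsLeftConsistent H φ (toFunctional (q y)))
    (hr : ∀ y, IsRightConsistent H φ (toFunctional (q y))) (f : C(Q, ℂ)) :
    Continuous fun z => toFunctional (q (φ z)) f := by
  let S : Submodule ℂ C(Q, ℂ) :=
    { carrier := {f | Continuous fun z => toFunctional (q (φ z)) f}
      add_mem' := fun {f g} hf hg => by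
        simp only [Set.mem_ofPred_eq, map_add] at *
        exact hf.add hg
      zero_mem' := by simp [continuous_const]
      smul_mem' := fun c f hf => by
        simp only [Set.mem_ofPred_eq, map_smul] at *
        exact hf.const_smul c }
  have hS : IsClosed (S : Set C(Q, ℂ)) := by
    refine isClosed_of_closure_subset fun f hf => ?_
    refine continuous_of_uniform_approx_of_continuous fun u hu => ?_
    obtain ⟨ε, hε, hεu⟩ := Metric.mem_uniformity_dist.1 hu
    obtain ⟨g, hg, hfg⟩ := Metric.mem_closure_iff.1 hf ε hε
    refine ⟨_, hg, fun z => hεu ?_⟩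
    rw [dist_eq_norm, ← map_sub]
    exact (norm_toFunctional_le _ _).trans_lt (by rwa [← dist_eq_norm])
  have hT : S = ⊤ := by
    refine eq_top_of_rightTranslate_mem hμ ha hS fun b hb x => ?_
    have h : (fun z => toFunctional (q (φ z)) (H.rightTranslate x b)) =
        idTensorFunctional (toFunctional (q (φ x))) (H.comul b) := by
      funext z
      rw [← toFunctional_orbit_eq hc (hr _ b hb) z, ← toFunctional_functionalTensorId,
        toFunctional_orbit_eq hc (hl _ b hb), H.functionalTensorId_comul_apply]
    change Continuous _
    rw [h]
    exact ContinuousMap.continuous _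
  have hf : f ∈ S := hT ▸ Submodule.mem_top
  exact hf

/-! ### From consistency to the conditional expectation -/

/-- The operator `(P f)(x) = ⟨q_{φ(x)}, f⟩`, provided that it maps into `C(Q)`. -/
def orbitAverage (φ : C(Q, Y)) (q : Y → Measure Q) [∀ y, IsProbabilityMeasure (q y)]
    (h : ∀ f : C(Q, ℂ), Continuous fun x => toFunctional (q (φ x)) f) :
    C(Q, ℂ) →L[ℂ] C(Q, ℂ) :=
  LinearMap.mkContinuous
    { toFun := fun f => ⟨fun x => toFunctional (q (φ x)) f, h f⟩
      map_add' := fun f g => by ext x; exact map_add (toFunctional (q (φ x))) f g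
      map_smul' := fun c f => by ext x; exact map_smul (toFunctional (q (φ x))) c f }
    1 (fun f => by
      rw [one_mul, ContinuousMap.norm_le _ (norm_nonneg f)]
      exact fun x => norm_toFunctional_le _ f)

theorem isConditionalExpectation_of_integral_orbit {Q Y : Type*} [TopologicalSpace Q]
    [CompactSpace Q] [MeasurableSpace Q] [BorelSpace Q] [TopologicalSpace Y] {φ : C(Q, Y)}
    {q : Y → Measure Q} [∀ y, IsProbabilityMeasure (q y)] [∀ y, (q y).Regular]
    (hc : ∀ y, (q y).support ⊆ φ ⁻¹' {y})
    {P : C(Q, ℂ) →L[ℂ] C(Q, ℂ)} (hP : ∀ f x, P f x = toFunctional (q (φ x)) f) :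
    IsConditionalExpectation (orbitAlgebra φ) P where
  mem f x x' h := by rw [hP, hP, h]
  apply_of_mem b hb := by ext x; rw [hP, toFunctional_orbit_eq hc hb]
  norm_le f := by
    rw [ContinuousMap.norm_le _ (norm_nonneg f)]
    intro x
    rw [hP]
    exact norm_toFunctional_le _ f
  nonneg f hf x := by
    rw [hP]
    exact integral_complex_nonneg _ (Filter.Eventually.of_forall hf)
  bimodule f a ha b hb := by
    ext x
    have h : toFunctional (q (φ x)) (a * f * b) = toFunctional (q (φ x)) ((a x * b x) • f) :=
      toFunctional_congr fun t ht => by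
        have h1 := ha t x (hc _ ht)
        have h2 := hb t x (hc _ ht)
        simp only [ContinuousMap.mul_apply, ContinuousMap.smul_apply, smul_eq_mul, h1, h2]
        ring
    rw [hP, h, map_smul, ← hP]
    simp only [ContinuousMap.mul_apply, smul_eq_mul]
    ring

/-- Each identity is an equality of left consistent measures that agree on `B`:
`μ ∘ P = μ`, `(q_x ∗ q_y) ∘ P = q_x ∗ q_y`, and the reflection of `q_x` is `q_{x†}`. -/
theorem isClassicalHypergroupExpectation_of_consistent [CompactSpace Y] [T2Space Y]
    (hμ : H.IsHaarMeasure μ)     (ha : φ ⁻¹' {φ H.e} = {H.e})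
    (hb : ∀ A : Set Q, IsOrbit φ A → IsOrbit φ (H.dagger '' A))
    (hc : ∀ y, (q y).support ⊆ φ ⁻¹' {y})
    (hl : ∀ y, IsLeftConsistent H φ (toFunctional (q y)))
    (hr : ∀ y, IsRightConsistent H φ (toFunctional (q y)))
    {P : C(Q, ℂ) →L[ℂ] C(Q, ℂ)} (hP : ∀ f x, P f x = toFunctional (q (φ x)) f) :
    IsClassicalHypergroupExpectation H μ (orbitAlgebra φ) P := by
  have := hμ.isProbabilityMeasure
  have hE := isConditionalExpectation_of_integral_orbit hc hP
  have hcompP : ∀ ξ : StrongDual ℂ C(Q, ℂ), IsLeftConsistent H φ (ξ ∘L P) := by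
    intro ξ b hb x x' hx
    rw [H.functionalTensorId_comul_apply, H.functionalTensorId_comul_apply]
    refine congrArg ξ ?_
    ext z
    exact (hP _ z).trans ((hl _ b hb x x' hx).trans (hP _ z).symm)
  have hPinv : ∀ ξ : StrongDual ℂ C(Q, ℂ), IsLeftConsistent H φ ξ → ξ ∘L P = ξ :=
    fun ξ hξ => (hcompP ξ).ext hμ ha hc hr hξ fun b hb => congrArg ξ (hE.apply_of_mem b hb)
  have hμl : IsLeftConsistent H φ (toFunctional μ) := fun b _ x x' _ =>
    (hμ.right_invariant b x).trans (hμ.right_invariant b x').symm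
  refine
    { isClosed := isClosed_orbitAlgebra φ
      isConditionalExpectation := hE
      invariant := fun f => DFunLike.congr_fun (hPinv _ hμl) f
      coideal := fun f => ?_
      map_starOp := fun f => ?_
      map_mem := fun _ _ => Algebra.mem_top
      tensor_map_mem := fun _ _ => Algebra.mem_top
      map_modular := fun _ _ _ => rfl
      counit_left := fun b hb => ?_
      counit_right := fun b hb => ?_ }
  · ext ⟨x, y⟩
    rw [inducedComul_apply hP, inducedComul_apply hP]
    exact (DFunLike.congr_fun (hPinv _ ((hl (φ x)).convolution (hl (φ y)))) f).symm
  · ext x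
    let reflectCLM : C(Q, ℂ) →L[ℂ] C(Q, ℂ) := pullback ⟨H.dagger, H.continuous_dagger⟩
    have h1 : toFunctional (q (φ x)) ∘L reflectCLM = toFunctional (q (φ (H.dagger x))) := by
      refine IsLeftConsistent.ext hμ ha hc hr ?_ (hl _) fun b hbB => ?_
      · intro b hbB
        suffices heq : functionalTensorId (toFunctional (q (φ x)) ∘L reflectCLM) (H.comul b) =
            H.reflect (idTensorFunctional (toFunctional (q (φ x)))
              (H.comul (H.reflect b))) by
          rw [heq]
          exact reflect_mem_orbitAlgebra hb (hr (φ x) _ (reflect_mem_orbitAlgebra hb hbB))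
        ext w
        refine congrArg (toFunctional (q (φ x))) ?_
        ext t
        refine Eq.symm ((H.comul_reflect b (H.dagger w) t).trans ?_)
        rw [H.dagger_dagger]
        rfl
      · rw [toFunctional_orbit_eq hc hbB]
        exact toFunctional_orbit_eq hc (reflect_mem_orbitAlgebra hb hbB) x
    have h2 := DFunLike.congr_fun h1 f
    rw [← hP] at h2
    rw [hP, H.starOp_eq, H.starOp_eq, ContinuousMap.star_apply, H.reflect_apply, ← h2]
    exact integral_conj
  · ext y
    refine (inducedComul_apply hP b H.e y).trans ?_
    refine (toFunctional_counit ha hc _).trans ?_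
    rw [← toFunctional_orbit_eq hc hb y]
    refine congrArg (toFunctional (q (φ y))) ?_
    ext t
    exact H.comul_e_left b t
  · ext x
    refine (inducedComul_apply hP b x H.e).trans ?_
    rw [← toFunctional_orbit_eq hc hb x]
    refine congrArg (toFunctional (q (φ x))) ?_
    ext t
    exact (toFunctional_counit ha hc _).trans (H.comul_e_right b t)

end Family

/-! ### The adjoint of a translation -/

namespace CompactHypergroup

variable (H : CompactHypergroup Q)

theorem norm_comul_apply_le (f : C(Q, ℂ)) (p : Q × Q) : ‖H.comul f p‖ ≤ ‖f‖ := by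
  have := H.isProbabilityMeasure_conv p.1 p.2
  exact norm_toFunctional_le (H.conv p.1 p.2) f

/-- The average `x ↦ ∫ f(x ∗ y) g(y) dμ(y)` of right translates of `f`. -/
def averageTranslate (μ : Measure Q) [IsFiniteMeasure μ] (g f : C(Q, ℂ)) : C(Q, ℂ) :=
  idTensorFunctional (toFunctional μ) (H.comul f * g.comp ⟨Prod.snd, continuous_snd⟩)

theorem map_averageTranslate (μ : Measure Q) [IsFiniteMeasure μ] (ξ : StrongDual ℂ C(Q, ℂ))
    (g f : C(Q, ℂ)) :
    ξ (H.averageTranslate μ g f) = ∫ y, functionalTensorId ξ (H.comul f) y * g y ∂μ := by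
  refine (toFunctional_functionalTensorId μ ξ _).symm.trans ?_
  refine integral_congr_ae (Filter.Eventually.of_forall fun y => ?_)
  have h : (flipCLM (H.comul f * g.comp ⟨Prod.snd, continuous_snd⟩)).curry y =
      g y • H.rightTranslate y f := by
    ext x
    exact mul_comm _ _
  refine (congrArg ξ h).trans ?_
  rw [map_smul, smul_eq_mul, mul_comm]
  rfl

variable {H} {μ : Measure Q}

/-- The adjoint in `L²(μ)` of the left translation by `z` is the left translation by `z†`.

For `u ≥ 0` concentrated near `e`, both sides, multiplied by `μ(u)`, are close to
`∫ ∫ u(s ∗ z ∗ y) k(s†) g(y) dμ(s) dμ(y)`: integrating first over `s` turns `u` into an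
approximate `δ_{s = (z ∗ y)†}` and leaves `k(z ∗ y)`, integrating first over `y` leaves
`g((s ∗ z)†) = g(z† ∗ s†)`. -/
theorem IsHaarMeasure.integral_comul_mul (hμ : H.IsHaarMeasure μ) (k g : C(Q, ℂ)) (z : Q) :
    ∫ y, H.comul k (z, y) * g y ∂μ = ∫ y, H.comul g (H.dagger z, y) * k y ∂μ := by
  have := hμ.isProbabilityMeasure
  rw [← sub_eq_zero, ← norm_le_zero_iff]
  refine le_of_forall_pos_le_add fun ε' hε' => ?_
  rw [zero_add]
  set C : ℝ := ‖g‖ + ‖k‖ + 1 with hC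
  have hCpos : 0 < C := by positivity
  have hε : 0 < ε' / C := by positivity
  obtain ⟨U, hU, heU, h1⟩ := hμ.exists_isOpen_norm_integral_le
    (G := ⟨fun p => g p.2 - H.reflect g p.1, by fun_prop⟩)
    (fun x => by simp [H.reflect_apply]) hε
  obtain ⟨V, hV, heV, h2⟩ := hμ.exists_isOpen_norm_integral_le
    (G := ⟨fun p => H.reflect k p.1 - k p.2, by fun_prop⟩)
    (fun x => by simp [H.reflect_apply]) hε
  obtain ⟨u, -, hu0, huUV, hue⟩ := exists_mem_orbitAlgebra_bump (φ := ContinuousMap.id Q)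
    (e := H.e) (by simp) (hU.inter hV) ⟨heU, heV⟩
  set c := ∫ y, u y ∂μ with hc
  have hc0 : c ≠ 0 := fun h0 => by
    have := hμ.eq_zero_of_integral_eq_zero hu0 h0
    rw [this] at hue
    simp at hue
  let κ : StrongDual ℂ C(Q, ℂ) := toFunctional μ ∘L ContinuousLinearMap.mul ℂ _ (H.reflect k)
  have hκ : ∀ f, κ f = ∫ s, H.reflect k s * f s ∂μ := fun f => rfl
  let K : C(Q, ℂ) := functionalTensorId κ (H.comul u)
  let J : C(Q, ℂ) := H.averageTranslate μ g u
  have hJ : ‖J - c • H.reflect g‖ ≤ ε' / C * ‖c‖ := by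
    rw [ContinuousMap.norm_le _ (by positivity)]
    intro x
    refine le_trans (le_of_eq ?_)
      (h1 u hu0 (fun x hx => huUV x fun h => hx h.1) x).1
    congr 1
    have h3 := hμ.left_invariant u x
    simp only [ContinuousMap.coe_mk, mul_sub]
    rw [integral_sub (integrable_of_continuous (by fun_prop) μ)
      (integrable_of_continuous (by fun_prop) μ), integral_mul_const, h3]
    rfl
  have hK : ‖K - c • k‖ ≤ ε' / C * ‖c‖ := by
    rw [ContinuousMap.norm_le _ (by positivity)]
    intro x
    refine le_trans (le_of_eq ?_)
      (h2 u hu0 (fun x hx => huUV x fun h => hx h.2) x).2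
    congr 1
    have h3 := hμ.right_invariant u x
    have h4 : K x = ∫ y, H.comul u (y, x) * H.reflect k y ∂μ :=
      integral_congr_ae (Filter.Eventually.of_forall fun y => mul_comm _ _)
    simp only [ContinuousMap.coe_mk, mul_sub]
    rw [integral_sub (integrable_of_continuous (by fun_prop) μ)
      (integrable_of_continuous (by fun_prop) μ), integral_mul_const, h3, ← h4]
    rfl
  have hM : ∫ y, H.comul K (z, y) * g y ∂μ = ∫ s, H.reflect k s * H.comul J (s, z) ∂μ := by
    have h5 := H.map_averageTranslate μ (H.convolution κ (ContinuousMap.evalCLM ℂ z)) g u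
    refine Eq.trans ?_ h5.symm
    refine integral_congr_ae (Filter.Eventually.of_forall fun y => ?_)
    exact congrArg (· * g y) (H.comul_functionalTensorId_comul κ u z y)
  have hI : ‖∫ y, H.comul K (z, y) * g y ∂μ - c * ∫ y, H.comul k (z, y) * g y ∂μ‖ ≤
      ε' / C * ‖c‖ * ‖g‖ := by
    have h6 : ∫ y, H.comul K (z, y) * g y ∂μ - c * ∫ y, H.comul k (z, y) * g y ∂μ =
        ∫ y, H.comul (K - c • k) (z, y) * g y ∂μ := by
      rw [← integral_const_mul, ← integral_sub (integrable_of_continuous (by fun_prop) μ)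
        (integrable_of_continuous (by fun_prop) μ)]
      refine integral_congr_ae (Filter.Eventually.of_forall fun y => ?_)
      simp only [map_sub, map_smul, ContinuousMap.sub_apply, ContinuousMap.smul_apply,
        smul_eq_mul]
      ring
    rw [h6]
    refine (norm_integral_le_of_norm_le_const (μ := μ) (C := ε' / C * ‖c‖ * ‖g‖)
      (Filter.Eventually.of_forall fun y => ?_)).trans_eq (by simp)
    rw [norm_mul]
    exact mul_le_mul ((H.norm_comul_apply_le _ _).trans hK) (g.norm_coe_le_norm y)
      (norm_nonneg _) (by positivity)
  have hL : ‖∫ s, H.reflect k s * H.comul J (s, z) ∂μ -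
      c * ∫ y, H.comul g (H.dagger z, y) * k y ∂μ‖ ≤ ε' / C * ‖c‖ * ‖k‖ := by
    have h7 : ∫ y, H.comul g (H.dagger z, y) * k y ∂μ =
        ∫ s, H.reflect k s * H.comul (H.reflect g) (s, z) ∂μ := by
      refine (hμ.integral_reflect (H.leftTranslate (H.dagger z) g * k)).symm.trans ?_
      refine integral_congr_ae (Filter.Eventually.of_forall fun s => ?_)
      simp only [H.comul_reflect]
      exact mul_comm _ _
    have h6 : ∫ s, H.reflect k s * H.comul J (s, z) ∂μ -
        c * ∫ y, H.comul g (H.dagger z, y) * k y ∂μ =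
        ∫ s, H.reflect k s * H.comul (J - c • H.reflect g) (s, z) ∂μ := by
      rw [h7, ← integral_const_mul, ← integral_sub (integrable_of_continuous (by fun_prop) μ)
        (integrable_of_continuous (by fun_prop) μ)]
      refine integral_congr_ae (Filter.Eventually.of_forall fun y => ?_)
      simp only [map_sub, map_smul, ContinuousMap.sub_apply, ContinuousMap.smul_apply,
        smul_eq_mul]
      ring
    rw [h6]
    refine (norm_integral_le_of_norm_le_const (μ := μ) (C := ε' / C * ‖c‖ * ‖k‖)
      (Filter.Eventually.of_forall fun y => ?_)).trans_eq (by simp)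
    rw [norm_mul, mul_comm]
    exact mul_le_mul ((H.norm_comul_apply_le _ _).trans hJ) (k.norm_coe_le_norm _)
      (norm_nonneg _) (by positivity)
  rw [hM] at hI
  have h8 := norm_sub_le_of_le hL hI
  have h9 : ‖c‖ * ‖∫ y, H.comul k (z, y) * g y ∂μ - ∫ y, H.comul g (H.dagger z, y) * k y ∂μ‖ ≤
      ‖c‖ * (ε' / C * (‖g‖ + ‖k‖)) := by
    rw [← norm_mul]
    refine le_trans (le_of_eq ?_) (h8.trans_eq (by ring))
    congr 1
    ring
  refine (le_of_mul_le_mul_left h9 (norm_pos_iff.2 hc0)).trans ?_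
  rw [div_mul_eq_mul_div, div_le_iff₀ hCpos]
  exact mul_le_mul_of_nonneg_left (by rw [hC]; linarith) hε'.le

end CompactHypergroup

/-! ### From the conditional expectation to consistency -/

variable {H : CompactHypergroup Q} {φ : C(Q, Y)} {μ : Measure Q}
  {q : Y → Measure Q} [∀ y, IsProbabilityMeasure (q y)] {P : C(Q, ℂ) →L[ℂ] C(Q, ℂ)}

/-- A `μ`-invariant conditional expectation is symmetric for the pairing `∫ f g dμ`. -/
theorem IsClassicalHypergroupExpectation.integral_mul_comm
    (hE : IsClassicalHypergroupExpectation H μ (orbitAlgebra φ) P) (f g : C(Q, ℂ)) :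
    ∫ x, (P f * g) x ∂μ = ∫ x, (f * P g) x ∂μ := by
  have h1 : P (P f * g) = P f * P g := by
    simpa using hE.isConditionalExpectation.bimodule g (P f) (hE.isConditionalExpectation.mem f)
      1 (one_mem _)
  have h2 : P (f * P g) = P f * P g := by
    simpa using hE.isConditionalExpectation.bimodule f 1 (one_mem _) (P g)
      (hE.isConditionalExpectation.mem g)
  rw [← hE.invariant, h1, ← h2, hE.invariant]

theorem IsClassicalHypergroupExpectation.toFunctional_reflect
    (hE : IsClassicalHypergroupExpectation H μ (orbitAlgebra φ) P)
    (hP : ∀ f x, P f x = toFunctional (q (φ x)) f) (f : C(Q, ℂ)) (x : Q) :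
    toFunctional (q (φ x)) (H.reflect f) = toFunctional (q (φ (H.dagger x))) f := by
  have h := DFunLike.congr_fun (hE.map_starOp f) x
  rw [hP, H.starOp_eq, H.starOp_eq, ContinuousMap.star_apply, H.reflect_apply, hP] at h
  refine star_injective (Eq.trans ?_ h)
  exact integral_conj.symm

/-- For `h = b(q_{φ(x)} ∗ ·)` and any `g`, the adjoint formula and the compatibility of `P` with
the involution give `∫ h g dμ = ∫ b · g(q_{φ(x†)} ∗ ·) dμ`. As `b ∈ B`, the second factor may be
replaced by its image under `P`, which by the coideal property depends on `P g` only. Hence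
`∫ h g dμ = ∫ h · P g dμ = ∫ P h · g dμ` for all `g`, so `h = P h` lies in `B`. -/
theorem IsClassicalHypergroupExpectation.isLeftConsistent (hμ : H.IsHaarMeasure μ)
    (hE : IsClassicalHypergroupExpectation H μ (orbitAlgebra φ) P)
    (hP : ∀ f x, P f x = toFunctional (q (φ x)) f) (x : Q) :
    IsLeftConsistent H φ (toFunctional (q (φ x))) := by
  have := hμ.isProbabilityMeasure
  intro b hb
  set h := functionalTensorId (toFunctional (q (φ x))) (H.comul b) with hh
  let A : C(Q, ℂ) → C(Q, ℂ) := fun g =>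
    functionalTensorId (toFunctional (q (φ (H.dagger x)))) (H.comul g)
  have h1 : ∀ g, ∫ w, (h * g) w ∂μ = ∫ w, (A g * b) w ∂μ := by
    intro g
    refine (H.map_averageTranslate μ _ g b).symm.trans ?_
    refine Eq.trans ?_ (H.map_averageTranslate μ _ b g)
    rw [← hE.toFunctional_reflect hP]
    congr 1
    ext z
    exact hμ.integral_comul_mul b g z
  have h2 : ∀ g, P (A g) = P (A (P g)) := by
    have h3 : ∀ g w, P (A g) w = inducedComul H P g (H.dagger x, w) := by
      intro g w
      rw [inducedComul_apply hP, hP, toFunctional_functionalTensorId]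
      rfl
    intro g
    ext w
    rw [h3, h3, hE.coideal]
  have h4 : ∀ g, ∫ w, (h * g) w ∂μ = ∫ w, (P h * g) w ∂μ := by
    intro g
    have hbP := hE.isConditionalExpectation.apply_of_mem b hb
    rw [hE.integral_mul_comm, h1, h1]
    have h5 := hE.integral_mul_comm (A g) b
    have h6 := hE.integral_mul_comm (A (P g)) b
    rw [hbP] at h5 h6
    rw [← h5, ← h6, h2]
  have h7 : (h - P h) * star (h - P h) = 0 := by
    refine hμ.eq_zero_of_integral_eq_zero (fun w => mul_star_self_nonneg ((h - P h) w)) ?_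
    rw [sub_mul]
    simp only [ContinuousMap.sub_apply]
    rw [integral_sub (integrable_of_continuous (ContinuousMap.continuous _) μ)
      (integrable_of_continuous (ContinuousMap.continuous _) μ), h4, sub_self]
  rw [CStarRing.mul_star_self_eq_zero_iff, sub_eq_zero] at h7
  rw [h7]
  exact hE.isConditionalExpectation.mem h

theorem IsClassicalHypergroupExpectation.isRightConsistent (hμ : H.IsHaarMeasure μ)
    (hb : ∀ A : Set Q, IsOrbit φ A → IsOrbit φ (H.dagger '' A))
    (hE : IsClassicalHypergroupExpectation H μ (orbitAlgebra φ) P)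
    (hP : ∀ f x, P f x = toFunctional (q (φ x)) f) (x : Q) :
    IsRightConsistent H φ (toFunctional (q (φ x))) := by
  intro b hbB
  suffices heq : idTensorFunctional (toFunctional (q (φ x))) (H.comul b) =
      H.reflect (functionalTensorId (toFunctional (q (φ (H.dagger x))))
        (H.comul (H.reflect b))) by
    rw [heq]
    exact reflect_mem_orbitAlgebra hb
      (hE.isLeftConsistent hμ hP (H.dagger x) _ (reflect_mem_orbitAlgebra hb hbB))
  ext w
  rw [H.reflect_apply, H.functionalTensorId_comul_apply, ← hE.toFunctional_reflect hP]
  refine congrArg (toFunctional (q (φ x))) ?_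
  ext t
  rw [H.reflect_apply, H.rightTranslate_apply, H.comul_reflect, H.dagger_dagger,
    H.dagger_dagger]
  rfl

end HypergroupExpectation

end

theorem proposition2p7 {Q Y : Type*} [TopologicalSpace Q] [CompactSpace Q] [T2Space Q]
    [MeasurableSpace Q] [BorelSpace Q] [TopologicalSpace Y] [CompactSpace Y] [T2Space Y]
    (H : HypergroupExpectation.CompactHypergroup Q)
    (μ : MeasureTheory.Measure Q) (hμ : H.IsHaarMeasure μ)
    (φ : C(Q, Y)) (hφ : HypergroupExpectation.IsOrbitalMap φ)
    (ha : φ ⁻¹' {φ H.e} = {H.e})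
    (hb : ∀ A : Set Q, HypergroupExpectation.IsOrbit φ A →
      HypergroupExpectation.IsOrbit φ (H.dagger '' A))
    (q : Y → MeasureTheory.Measure Q)
    [∀ y, MeasureTheory.IsProbabilityMeasure (q y)] [∀ y, (q y).Regular]
    (hc : ∀ y, (q y).support ⊆ φ ⁻¹' {y}) :
    ((∀ y, HypergroupExpectation.IsConsistent H φ (HypergroupExpectation.toFunctional (q y))) →
      ∃ P : C(Q, ℂ) →L[ℂ] C(Q, ℂ),
        (∀ f x, P f x = ∫ t, f t ∂(q (φ x))) ∧
        HypergroupExpectation.IsClassicalHypergroupExpectation H μ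
          (HypergroupExpectation.orbitAlgebra φ) P) ∧
    (∀ P : C(Q, ℂ) →L[ℂ] C(Q, ℂ),
      (∀ f x, P f x = ∫ t, f t ∂(q (φ x))) →
      HypergroupExpectation.IsClassicalHypergroupExpectation H μ
        (HypergroupExpectation.orbitAlgebra φ) P →
      ∀ y, HypergroupExpectation.IsConsistent H φ
        (HypergroupExpectation.toFunctional (q y))) := by
  constructor
  · intro h
    have hl := fun y => ((h y).isLeftConsistent_and_isRightConsistent hφ).1
    have hr := fun y => ((h y).isLeftConsistent_and_isRightConsistent hφ).2
    exact ⟨HypergroupExpectation.orbitAverage φ q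
        (HypergroupExpectation.continuous_integral_orbit hμ ha hc hl hr), fun _ _ => rfl,
      HypergroupExpectation.isClassicalHypergroupExpectation_of_consistent hμ ha hb hc hl hr
        fun _ _ => rfl⟩
  · intro P hP hE y
    obtain ⟨x, rfl⟩ := hφ.surjective y
    exact HypergroupExpectation.isConsistent_toFunctional hφ (hE.isLeftConsistent hμ hP x)
      (hE.isRightConsistent hμ hb hP x)
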